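/- Let $\mathbb F_q$ be the finite field with $q$ elements, $\theta>0$ a real number, and fix linear embeddings $\mathbb F_q^0\hookrightarrow\mathbb F_q^1\hookrightarrow\mathbb F_q^2\hookrightarrow\cdots$, by which $\mathbb F_q^n$ is identified with a subspace of $\mathbb F_q^{n+1}$. Let $\operatorname{Gr}(n)$ be the set of all vector subspaces of $\mathbb F_q^n$. For $w\in\operatorname{Gr}(n)$ let $$\operatorname{Dil}_{n+1}(w)=\{v\in\operatorname{Gr}(n+1): w\subset v,\ v\not\subset\mathbb F_q^n,\ \dim v-\dim w=1\}.$$ Let $X_1,X_2,\dots$ be independent random variables with $\Pr(X_i=1)=\frac{\theta q^{i-1}}{1+\theta q^{i-1}}$ and $\Pr(X_i=0)=\frac{1}{1+\theta q^{i-1}}$. Let $(V_n)_{n\ge 0}$ be the associated Grassmannian process: $V_n$ takes values in $\operatorname{Gr}(n)$, $V_0=\mathbb F_q^0$, and for every $n\ge 0$ the variable $X_{n+1}$ is independent of $V_n$ and $$\Pr(V_{n+1}=v\mid V_n=w,X_{n+1}=0)=\begin{cases}1&\text{if } v=w,\\0&\text{otherwise,}\end{cases}\qquad \Pr(V_{n+1}=v\mid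 V_n=w,X_{n+1}=1)=\begin{cases}|\operatorname{Dil}_{n+1}(w)|^{-1}&\text{if } v\in\operatorname{Dil}_{n+1}(w),\\0&\text{otherwise.}\end{cases}$$ With $(a;x)_\infty=\prod_{k\ge 0}(1-ax^k)$, put, for $d\in\mathbb N=\{0,1,2,\dots\}$, $$\mu(d)=\frac{q^{-\frac12\left(d-(\frac12-\log_q\theta)\right)^2+\frac12\left(\frac12-\log_q\theta\right)^2}\,(q^{-(d+1)};q^{-1})_\infty}{(q^{-1};q^{-1})_\infty\,(-\theta^{-1};q^{-1})_\infty},$$ which is a probability mass function on $\mathbb N$, and let $\Delta:[0,1)\to\mathbb N$ send $p$ to the smallest $d$ with $\sum_{k=0}^d\mu(k)\ge p$. An $n$-to-$k$ $q$-ary block code is a pair of maps $f:\operatorname{Gr}(n)\to\{1,\dots,q\}^k$ and $\phi:\{1,\dots,q\}^k\to\operatorname{Gr}(n)$; its probability of error for $V_n$ is $\Pr(\phi(f(V_n))\ne V_n)$. Let $k(n,\epsilon)$ be the smallest $k$ such that there is an $n$-to-$k$ $q$-ary block code with probability of error at most $\epsilon$. **Proposition.** For every $\epsilon\in(0,1]$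 such that $1-\epsilon$ is a continuity point of $\Delta$, $$\lim_{n\to\infty}\frac{k(n,\epsilon)}{n}=\Delta(1-\epsilon).$$ -/

import Mathlib

open MeasureTheory ProbabilityTheory Filter Topology

/-- The total Grassmannian `Gr(n)`: all vector subspaces of `F ^ n`. -/
abbrev Gr (F : Type*) [Field F] (n : ℕ) : Type _ := Submodule F (Fin n → F)

/-- `Gr(n)` (finite when `F` is) carries the discrete σ-algebra. -/
instance instMeasurableSpaceGr (F : Type*) [Field F] (n : ℕ) : MeasurableSpace (Gr F n) := ⊤

/-- The dilations of `w ⊆ F ^ n` inside `F ^ (n + 1)`, where `F ^ n` is identified with its image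
under the linear embedding `j`: the subspaces `v` of `F ^ (n + 1)` that contain `w`, are not
contained in `F ^ n`, and satisfy `dim v - dim w = 1`. -/
def dilations {F : Type*} [Field F] {n : ℕ} (j : (Fin n → F) →ₗ[F] (Fin (n + 1) → F))
    (w : Gr F n) : Set (Gr F (n + 1)) :=
  {v | w.map j ≤ v ∧ ¬ v ≤ LinearMap.range j ∧ Module.finrank F v = Module.finrank F w + 1}

/-- `V` is the Grassmannian process on the probability space `(Ω, P)` associated with the
`q`-binomial process of parameter `θ` whose increments are `X`, with respect to the linear
embeddings `j n : F ^ n → F ^ (n + 1)`; here `q` is the cardinality of `F`.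
The variable `X n` is the increment of step `n + 1`, that is, it decides between
`V (n + 1) = V n` and a uniformly chosen dilation of `V n`. -/
structure IsGrassmannianProcess {F : Type*} [Field F]
    (j : (n : ℕ) → (Fin n → F) →ₗ[F] (Fin (n + 1) → F)) (θ : ℝ)
    {Ω : Type*} [MeasurableSpace Ω] (P : Measure Ω)
    (X : ℕ → Ω → ℕ) (V : (n : ℕ) → Ω → Gr F n) : Prop where
  measurable_X : ∀ n, Measurable (X n)
  measurable_V : ∀ n, Measurable (V n)
  /-- The increments are independent Bernoulli variables. -/
  iIndepFun_X : iIndepFun X P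
  prob_X_one : ∀ n, P.real {ω | X n ω = 1} =
    θ * (Nat.card F : ℝ) ^ n / (1 + θ * (Nat.card F : ℝ) ^ n)
  prob_X_zero : ∀ n, P.real {ω | X n ω = 0} = 1 / (1 + θ * (Nat.card F : ℝ) ^ n)
  V_zero : ∀ ω, V 0 ω = ⊥
  /-- The increment of step `n + 1` is independent of the state at time `n`. -/
  indepFun_V_X : ∀ n, IndepFun (V n) (X n) P
  /-- Given `V n = w` and increment `0`, the process stays at `w`. -/
  cond_zero : ∀ (n : ℕ) (w : Gr F n) (v : Gr F (n + 1)),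
    P ({ω | V n ω = w} ∩ {ω | X n ω = 0}) ≠ 0 →
      (P[|{ω | V n ω = w} ∩ {ω | X n ω = 0}]).real {ω | V (n + 1) ω = v} =
        Set.indicator {w.map (j n)} (fun _ => (1 : ℝ)) v
  /-- Given `V n = w` and increment `1`, the next state is uniform on the dilations of `w`. -/
  cond_one : ∀ (n : ℕ) (w : Gr F n) (v : Gr F (n + 1)),
    P ({ω | V n ω = w} ∩ {ω | X n ω = 1}) ≠ 0 →
      (P[|{ω | V n ω = w} ∩ {ω | X n ω = 1}]).real {ω | V (n + 1) ω = v} =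
        Set.indicator (dilations (j n) w) (fun _ => (1 : ℝ)) v / ((dilations (j n) w).ncard : ℝ)

/-- The infinite Pochhammer symbol `(a; x)_∞ = ∏_{k ≥ 0} (1 - a x ^ k)`, used for `|x| < 1`, where
the product converges absolutely. -/
noncomputable def qPochInf (a x : ℝ) : ℝ := ∏' k : ℕ, (1 - a * x ^ k)

/-- The mass `μ(d)` of the limit law of the codimension:
`q ^ (-(d - (1/2 - log_q θ))² / 2 + (1/2 - log_q θ)² / 2) * (q ^ (-(d + 1)); q⁻¹)_∞ /
((q⁻¹; q⁻¹)_∞ * (-θ⁻¹; q⁻¹)_∞)`. -/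
noncomputable def limitMass (q : ℕ) (θ : ℝ) (d : ℕ) : ℝ :=
  (q : ℝ) ^ (-(1 / 2 : ℝ) * ((d : ℝ) - (1 / 2 - Real.logb q θ)) ^ 2
      + (1 / 2 : ℝ) * (1 / 2 - Real.logb q θ) ^ 2)
    * qPochInf (((q : ℝ)⁻¹) ^ (d + 1)) (q : ℝ)⁻¹
    / (qPochInf (q : ℝ)⁻¹ (q : ℝ)⁻¹ * qPochInf (-θ⁻¹) (q : ℝ)⁻¹)

/-- `Δ(p)`: the smallest `d` with `μ(0) + ⋯ + μ(d) ≥ p`. The function is used on `[0, 1)`. -/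
noncomputable def quantileIndex (q : ℕ) (θ : ℝ) (p : ℝ) : ℕ :=
  sInf {d : ℕ | p ≤ ∑ k ∈ Finset.range (d + 1), limitMass q θ k}

/-- The probability of error of the `n`-to-`k` block code `(f, φ)` over the alphabet `Fin q`, for a
random subspace `W`. -/
noncomputable def codeError {F : Type*} [Field F] {n k q : ℕ} {Ω : Type*} [MeasurableSpace Ω]
    (P : Measure Ω) (W : Ω → Gr F n)
    (f : Gr F n → (Fin k → Fin q)) (φ : (Fin k → Fin q) → Gr F n) : ℝ :=
  P.real {ω | φ (f (W ω)) ≠ W ω}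

/-- The smallest `k` for which some `n`-to-`k` `q`-ary block code has error at most `ε`. -/
noncomputable def minCodeLength {F : Type*} [Field F] {n : ℕ} {Ω : Type*} [MeasurableSpace Ω]
    (P : Measure Ω) (W : Ω → Gr F n) (q : ℕ) (ε : ℝ) : ℕ :=
  sInf {k : ℕ | ∃ (f : Gr F n → (Fin k → Fin q)) (φ : (Fin k → Fin q) → Gr F n),
    codeError P W f φ ≤ ε}

/-- The set defining `minCodeLength` is nonempty, so the minimum is attained. -/
theorem exists_code_error_le {F : Type*} [Field F] [Finite F] {n : ℕ} {Ω : Type*}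
    [MeasurableSpace Ω] (P : Measure Ω) (W : Ω → Gr F n) (q : ℕ) (hq : 2 ≤ q) (ε : ℝ)
    (hε : 0 ≤ ε) :
    ∃ (k : ℕ) (f : Gr F n → (Fin k → Fin q)) (φ : (Fin k → Fin q) → Gr F n),
      codeError P W f φ ≤ ε := by
  classical
  have := Fintype.ofFinite (Gr F n)
  have hcard : Fintype.card (Gr F n) ≤ Fintype.card (Fin (Fintype.card (Gr F n)) → Fin q) := by
    simpa using (Nat.lt_pow_self (n := Fintype.card (Gr F n)) (show 1 < q by omega)).le
  obtain ⟨f⟩ := Function.Embedding.nonempty_of_card_le hcard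
  refine ⟨_, f, Function.invFun f, ?_⟩
  simpa [codeError, Function.leftInverse_invFun f.injective _] using hε

/-! ### Hyperplane sections and dilations of a subspace. -/

section LinearAlgebra

variable {F : Type*} [Field F] {n : ℕ} {j : (Fin n → F) →ₗ[F] (Fin (n + 1) → F)}

/-! The law of `V n` is constant on each codimension class. A subspace `v` of `F ^ (n + 1)` has only
one possible predecessor, its trace `v.comap j` on the hyperplane `F ^ n`. Whether `v` lies in the
hyperplane decides which increment occurred, and a subspace of codimension `d` has `q ^ d`
dilations. Induction gives the explicit mass `codimMass` (`IsGrassmannianProcess.real_V_eq`), which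
for fixed `d` is of order `q ^ (-n * d)`. The class itself is counted by a Gaussian binomial of
order `q ^ (n * d)`. The product of the two converges to `limitMass` (`tendsto_codim`), and a
dominating sequence uniform in `n` shows that no mass escapes (`hasSum_limitMass`).

Let `D` be the quantile index of `1 - ε`. Upper bound: continuity of the quantile makes the limiting
mass of the codimensions at most `D` strictly larger than `1 - ε`, so for large `n` it suffices to
encode those subspaces, of which there are `O(q ^ (n * D))` (`eventually_minCodeLength_le`).

Lower bound: the codimensions below `D` have limiting mass below `1 - ε`. The decodable set of a
good code must therefore gain a fixed positive probability from codimensions in a window `[D, E)`,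
where each point has mass `O(q ^ (-n * D))`, and so it has at least a constant times `q ^ (n * D)`
elements (`eventually_le_minCodeLength`). The minimal length is thus `n * D + O(1)`. -/

theorem finrank_map_of_injective (hj : Function.Injective j) (w : Gr F n) :
    Module.finrank F (w.map j) = Module.finrank F w :=
  (Submodule.equivMapOfInjective j hj w).finrank_eq.symm

theorem finrank_range_of_injective (hj : Function.Injective j) :
    Module.finrank F (LinearMap.range j) = n := by
  rw [LinearMap.finrank_range_of_inj hj]; simp

theorem range_sup_eq_top (hj : Function.Injective j) {v : Gr F (n + 1)}
    (hv : ¬ v ≤ LinearMap.range j) : LinearMap.range j ⊔ v = ⊤ := by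
  have h1 : LinearMap.range j < LinearMap.range j ⊔ v := by
    rw [left_lt_sup]; exact hv
  have h2 := Submodule.finrank_lt_finrank_of_lt h1
  rw [finrank_range_of_injective hj] at h2
  apply Submodule.eq_top_of_finrank_eq
  have h3 := Submodule.finrank_le (LinearMap.range j ⊔ v)
  simp only [Module.finrank_fin_fun] at h3 ⊢
  omega

theorem finrank_eq_finrank_comap_add_one (hj : Function.Injective j) {v : Gr F (n + 1)}
    (hv : ¬ v ≤ LinearMap.range j) :
    Module.finrank F v = Module.finrank F (v.comap j) + 1 := by
  have h := Submodule.finrank_sup_add_finrank_inf_eq (LinearMap.range j) v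
  rw [range_sup_eq_top hj hv, finrank_range_of_injective hj, ← Submodule.map_comap_eq,
    finrank_map_of_injective hj, finrank_top, Module.finrank_fin_fun] at h
  omega

theorem finrank_comap_of_le_range (hj : Function.Injective j) {v : Gr F (n + 1)}
    (hv : v ≤ LinearMap.range j) :
    Module.finrank F (v.comap j) = Module.finrank F v := by
  rw [← finrank_map_of_injective hj, Submodule.map_comap_eq_of_le hv]

/-- A subspace outside the hyperplane `range j` meets it in dimension exactly one less, so the
dimension condition turns the inclusion of `w` into equality with the trace. The dilations of
distinct subspaces are therefore disjoint. -/
theorem mem_dilations_iff (hj : Function.Injective j) {w : Gr F n} {v : Gr F (n + 1)} :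
    v ∈ dilations j w ↔ ¬ v ≤ LinearMap.range j ∧ v.comap j = w := by
  constructor
  · rintro ⟨h1, h2, h3⟩
    refine ⟨h2, ?_⟩
    have h4 := finrank_eq_finrank_comap_add_one hj h2
    exact (Submodule.eq_of_le_of_finrank_eq (Submodule.map_le_iff_le_comap.1 h1)
      (by omega)).symm
  · rintro ⟨h1, rfl⟩
    exact ⟨Submodule.map_comap_le _ _, h1, finrank_eq_finrank_comap_add_one hj h1⟩

theorem exists_notMem_range (hj : Function.Injective j) : ∃ u, u ∉ LinearMap.range j := by
  by_contra! h
  have h1 : LinearMap.range j = ⊤ := (Submodule.eq_top_iff').2 h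
  have h2 := finrank_range_of_injective hj
  rw [h1, finrank_top, Module.finrank_fin_fun] at h2
  omega

/-- The dilation of `w` spanned by `w` and `u + j x`. -/
def spanDilation (j : (Fin n → F) →ₗ[F] (Fin (n + 1) → F)) (w : Gr F n) (u : Fin (n + 1) → F)
    (x : Fin n → F) : Gr F (n + 1) :=
  w.map j ⊔ Submodule.span F {u + j x}

theorem add_map_notMem_range {u : Fin (n + 1) → F} (hu : u ∉ LinearMap.range j) (x : Fin n → F) :
    u + j x ∉ LinearMap.range j := fun h =>
  hu ((Submodule.add_mem_iff_left _ (LinearMap.mem_range_self j x)).1 h)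

theorem spanDilation_mem_dilations (hj : Function.Injective j) (w : Gr F n)
    {u : Fin (n + 1) → F} (hu : u ∉ LinearMap.range j) (x : Fin n → F) :
    spanDilation j w u x ∈ dilations j w := by
  have hx := add_map_notMem_range hu x
  refine ⟨le_sup_left, fun h => hx (h (Submodule.mem_sup_right
    (Submodule.mem_span_singleton_self _))), ?_⟩
  rw [spanDilation, Submodule.finrank_sup_span_singleton, finrank_map_of_injective hj]
  exact fun h => hx (LinearMap.map_le_range h)

theorem spanDilation_eq_iff (hj : Function.Injective j) (w : Gr F n)
    {u : Fin (n + 1) → F} (hu : u ∉ LinearMap.range j) (x y : Fin n → F) :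
    spanDilation j w u x = spanDilation j w u y ↔ x - y ∈ w := by
  have key : u + j x ∈ spanDilation j w u y ↔ x - y ∈ w := by
    rw [spanDilation, Submodule.mem_sup]
    constructor
    · rintro ⟨_, ⟨a, ha, rfl⟩, b, hb, hab⟩
      obtain ⟨c, rfl⟩ := Submodule.mem_span_singleton.1 hb
      have h1 : (1 - c) • u = j (a + c • y - x) := by
        simp only [map_add, map_sub, map_smul, sub_smul, one_smul]
        rw [smul_add] at hab
        rw [sub_eq_iff_eq_add, ← sub_eq_zero]
        rw [← sub_eq_zero] at hab
        rw [← neg_eq_zero, ← hab]; abel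
      -- Modulo `range j` only the multiples of `u` survive, and `u` is not in `range j`.
      have hc : c = 1 := by
        by_contra hc
        refine hu ⟨(1 - c)⁻¹ • (a + c • y - x), ?_⟩
        rw [map_smul, ← h1, smul_smul, inv_mul_cancel₀ (sub_ne_zero.2 (Ne.symm hc)), one_smul]
      subst hc
      rw [sub_self, zero_smul, one_smul] at h1
      have h2 := hj ((map_zero j).trans h1)
      rwa [show x - y = a by rw [← sub_eq_zero, ← neg_eq_zero, h2]; abel]
    · intro h
      refine ⟨j (x - y), ⟨_, h, rfl⟩, _, Submodule.mem_span_singleton_self _, ?_⟩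
      rw [map_sub]; abel
  rw [← key]
  constructor
  · intro h
    rw [← h]
    exact Submodule.mem_sup_right (Submodule.mem_span_singleton_self _)
  · intro h
    apply Submodule.eq_of_le_of_finrank_eq
    · refine sup_le le_sup_left ?_
      rwa [Submodule.span_singleton_le_iff_mem]
    · rw [(spanDilation_mem_dilations hj w hu x).2.2, (spanDilation_mem_dilations hj w hu y).2.2]

theorem exists_spanDilation_eq (hj : Function.Injective j) (w : Gr F n)
    {u : Fin (n + 1) → F} (hu : u ∉ LinearMap.range j) {v : Gr F (n + 1)}
    (hv : v ∈ dilations j w) : ∃ x, spanDilation j w u x = v := by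
  obtain ⟨z, hzv, hz⟩ := Set.not_subset.1 hv.2.1
  have htop : LinearMap.range j ⊔ Submodule.span F {u} = ⊤ := range_sup_eq_top hj
    (fun h => hu (h (Submodule.mem_span_singleton_self _)))
  obtain ⟨_, ⟨y, rfl⟩, b, hb, hab⟩ := Submodule.mem_sup.1 (htop ▸ Submodule.mem_top (x := z))
  obtain ⟨c, rfl⟩ := Submodule.mem_span_singleton.1 hb
  have hc : c ≠ 0 := by
    rintro rfl
    exact hz ⟨y, by simpa using hab⟩
  refine ⟨c⁻¹ • y, ?_⟩
  have hmem : u + j (c⁻¹ • y) ∈ v := by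
    have : u + j (c⁻¹ • y) = c⁻¹ • z := by
      rw [← hab, smul_add, smul_smul, inv_mul_cancel₀ hc, one_smul, map_smul]; abel
    rw [this]
    exact v.smul_mem _ hzv
  apply Submodule.eq_of_le_of_finrank_eq
  · refine sup_le hv.1 ?_
    rwa [Submodule.span_singleton_le_iff_mem]
  · rw [(spanDilation_mem_dilations hj w hu _).2.2, hv.2.2]

/-- For a fixed `u` off the hyperplane, every dilation is spanned by `w` and some `u + j x`, with
`x` unique modulo `w`. Dilations thus correspond to points of the quotient `F ^ n / w`, of dimension
`d`. -/
theorem ncard_dilations (hj : Function.Injective j) (w : Gr F n) {d : ℕ}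
    (hd : Module.finrank F w + d = n) : (dilations j w).ncard = Nat.card F ^ d := by
  obtain ⟨u, hu⟩ := exists_notMem_range hj
  let g : ((Fin n → F) ⧸ w) → dilations j w := fun a => Quotient.liftOn' a
    (fun x => ⟨spanDilation j w u x, spanDilation_mem_dilations hj w hu x⟩)
    (fun x y h => Subtype.ext ((spanDilation_eq_iff hj w hu x y).2
      ((Submodule.quotientRel_def w).1 h)))
  have hg : Function.Bijective g := by
    constructor
    · intro a b
      induction a using Submodule.Quotient.induction_on with | _ x
      induction b using Submodule.Quotient.induction_on with | _ y
      intro h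
      exact (Submodule.Quotient.eq w).2 ((spanDilation_eq_iff hj w hu x y).1
        (congrArg Subtype.val h))
    · rintro ⟨v, hv⟩
      obtain ⟨x, hx⟩ := exists_spanDilation_eq hj w hu hv
      exact ⟨Submodule.Quotient.mk x, Subtype.ext hx⟩
  rw [← Nat.card_coe_set_eq, ← Nat.card_eq_of_bijective g hg,
    Module.natCard_eq_pow_finrank (K := F)]
  congr 1
  have := Submodule.finrank_quotient_add_finrank w
  rw [Module.finrank_fin_fun] at this
  omega

end LinearAlgebra

/-! ### Gaussian binomial count of subspaces by codimension. -/

section Counting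

variable {F : Type*} [Field F]

/-- The subspaces of `F ^ n` of codimension `d`. -/
def codimSet (F : Type*) [Field F] (n d : ℕ) : Set (Gr F n) :=
  {w | Module.finrank F w + d = n}

theorem ncard_codimSet_zero_right (n : ℕ) : (codimSet F n 0).ncard = 1 := by
  rw [Set.ncard_eq_one]
  refine ⟨⊤, Set.ext fun w => ?_⟩
  simp only [codimSet, add_zero, Set.mem_ofPred_eq, Set.mem_singleton_iff]
  constructor
  · intro h
    exact Submodule.eq_top_of_finrank_eq (by simpa using h)
  · rintro rfl
    simp

theorem ncard_codimSet_zero_succ (d : ℕ) : (codimSet F 0 (d + 1)).ncard = 0 := by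
  rw [show codimSet F 0 (d + 1) = ∅ from Set.eq_empty_of_forall_notMem fun w hw => by
    simp [codimSet] at hw]
  simp

/-- The `q`-Pascal rule: a subspace either lies in the hyperplane, where its codimension drops by
one, or is a dilation of its trace, which has the same codimension. -/
theorem ncard_codimSet_succ_succ [Finite F] {n : ℕ} {j : (Fin n → F) →ₗ[F] (Fin (n + 1) → F)}
    (hj : Function.Injective j) (d : ℕ) :
    (codimSet F (n + 1) (d + 1)).ncard =
      (codimSet F n d).ncard + Nat.card F ^ (d + 1) * (codimSet F n (d + 1)).ncard := by
  classical
  have := Fintype.ofFinite (Gr F n)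
  have := Fintype.ofFinite (Gr F (n + 1))
  have h1 : codimSet F (n + 1) (d + 1) =
      (Submodule.map j '' codimSet F n d) ∪
        {v | ¬ v ≤ LinearMap.range j ∧ v.comap j ∈ codimSet F n (d + 1)} := by
    ext v
    constructor
    · intro hv
      change Module.finrank F v + (d + 1) = n + 1 at hv
      by_cases h : v ≤ LinearMap.range j
      · refine Or.inl ⟨v.comap j, ?_, Submodule.map_comap_eq_of_le h⟩
        change Module.finrank F (v.comap j) + d = n
        rw [finrank_comap_of_le_range hj h]; omega
      · refine Or.inr ⟨h, ?_⟩
        change Module.finrank F (v.comap j) + (d + 1) = n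
        have := finrank_eq_finrank_comap_add_one hj h
        omega
    · rintro (⟨w, hw, rfl⟩ | ⟨h, hv⟩)
      · change Module.finrank F (w.map j) + (d + 1) = n + 1
        change Module.finrank F w + d = n at hw
        rw [finrank_map_of_injective hj]; omega
      · change Module.finrank F (v.comap j) + (d + 1) = n at hv
        change Module.finrank F v + (d + 1) = n + 1
        rw [finrank_eq_finrank_comap_add_one hj h]; omega
  rw [h1, Set.ncard_union_eq, Set.ncard_image_of_injective _ (Submodule.map_injective_of_injective hj)]
  · congr 1
    rw [Set.ncard_eq_toFinset_card', Finset.card_eq_sum_card_fiberwise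
      (f := fun v => v.comap j) (t := (codimSet F n (d + 1)).toFinset), 
      Set.ncard_eq_toFinset_card', mul_comm, ← smul_eq_mul, ← Finset.sum_const]
    · refine Finset.sum_congr rfl fun w hw => ?_
      rw [← ncard_dilations hj w (d := d + 1) ((Set.mem_toFinset (s := codimSet F n (d + 1))).1 hw),
        Set.ncard_eq_toFinset_card']
      congr 1
      ext v
      simp only [Finset.mem_filter, Set.mem_toFinset, Set.mem_ofPred_eq, mem_dilations_iff hj]
      constructor
      · exact fun h => ⟨h.1.1, h.2⟩
      · rintro ⟨h, rfl⟩
        exact ⟨⟨h, (Set.mem_toFinset (s := codimSet F n (d + 1))).1 hw⟩, rfl⟩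
    · intro v hv
      simp only [Set.coe_toFinset, Set.mem_ofPred_eq] at hv ⊢
      exact hv.2
  · rw [Set.disjoint_left]
    rintro _ ⟨w, -, rfl⟩ h
    exact h.1 LinearMap.map_le_range

/-- The product formula for Gaussian binomials, cross-multiplied so that the `q`-Pascal induction
needs no division. -/
theorem ncard_codimSet_mul_prod [Finite F] {j : (n : ℕ) → (Fin n → F) →ₗ[F] (Fin (n + 1) → F)}
    (hj : ∀ n, Function.Injective (j n)) (n d : ℕ) :
    ((codimSet F n d).ncard : ℝ) *
      ∏ i ∈ Finset.range d, ((Nat.card F : ℝ) ^ d - (Nat.card F : ℝ) ^ i) =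
      ∏ i ∈ Finset.range d, ((Nat.card F : ℝ) ^ n - (Nat.card F : ℝ) ^ i) := by
  -- Split off the factor `i = 0` and take one power of `q` out of each of the others.
  have step : ∀ n d : ℕ,
      ∏ i ∈ Finset.range (d + 1), ((Nat.card F : ℝ) ^ (n + 1) - (Nat.card F : ℝ) ^ i) =
        ((Nat.card F : ℝ) ^ (n + 1) - 1) * (Nat.card F : ℝ) ^ d *
          ∏ i ∈ Finset.range d, ((Nat.card F : ℝ) ^ n - (Nat.card F : ℝ) ^ i) := by
    intro n d
    rw [Finset.prod_range_succ', pow_zero, mul_comm, mul_assoc]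
    congr 1
    rw [← Finset.card_range d, ← Finset.prod_const, Finset.card_range, ← Finset.prod_mul_distrib]
    exact Finset.prod_congr rfl fun i _ => by ring
  induction n generalizing d with
  | zero =>
    cases d with
    | zero => simp [ncard_codimSet_zero_right]
    | succ d => rw [ncard_codimSet_zero_succ, Finset.prod_range_succ' _ d,
        Finset.prod_range_succ' (fun i => (Nat.card F : ℝ) ^ 0 - (Nat.card F : ℝ) ^ i)]; simp
  | succ n ih =>
    cases d with
    | zero => simp [ncard_codimSet_zero_right]
    | succ d =>
      have h1 := ih d
      have h2 := ih (d + 1)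
      rw [Finset.prod_range_succ (fun i => (Nat.card F : ℝ) ^ n - (Nat.card F : ℝ) ^ i)] at h2
      rw [ncard_codimSet_succ_succ (hj n), step n d, ← h1]
      rw [← h1] at h2
      push_cast
      rw [add_mul, mul_assoc _ _ (Finset.prod _ _), h2, step d d]
      ring

end Counting

/-! ### Exact law of the Grassmannian process. -/

section Law

variable {F : Type*} [Field F] {j : (n : ℕ) → (Fin n → F) →ₗ[F] (Fin (n + 1) → F)}
  {θ : ℝ} {Ω : Type*} [MeasurableSpace Ω] {P : Measure Ω}
  {X : ℕ → Ω → ℕ} {V : (n : ℕ) → Ω → Gr F n}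

theorem measurableSet_Gr_eq {n : ℕ} {W : Ω → Gr F n} (hW : Measurable W) (s : Set (Gr F n)) :
    MeasurableSet {ω | W ω ∈ s} :=
  hW (MeasurableSpace.measurableSet_top (s := s))

/-- On a null conditioning event both sides vanish, so the nonvanishing condition in the transition
rules costs nothing. -/
theorem real_inter_eq_of_cond [IsFiniteMeasure P] {A B : Set Ω} (hA : MeasurableSet A) {c : ℝ}
    (h : P A ≠ 0 → (P[|A]).real B = c) : P.real (A ∩ B) = P.real A * c := by
  by_cases h0 : P A = 0
  · have h1 : P (A ∩ B) = 0 := measure_mono_null Set.inter_subset_left h0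
    simp [Measure.real, h0, h1]
  · rw [← h h0]
    simp only [Measure.real]
    rw [← ENNReal.toReal_mul, mul_comm, cond_mul_eq_inter hA]

namespace IsGrassmannianProcess

theorem real_inter_X (hV : IsGrassmannianProcess j θ P X V)
    {n : ℕ} (w : Gr F n) (x : ℕ) :
    P.real ({ω | V n ω = w} ∩ {ω | X n ω = x}) = P.real {ω | V n ω = w} * P.real {ω | X n ω = x} := by
  have h := (hV.indepFun_V_X n).measure_inter_preimage_eq_mul {w} {x}
    MeasurableSpace.measurableSet_top (MeasurableSet.singleton x)
  have := congrArg ENNReal.toReal h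
  rw [ENNReal.toReal_mul] at this
  exact this

theorem ae_X [IsProbabilityMeasure P] (hV : IsGrassmannianProcess j θ P X V)
    (hθ : 0 < θ) (n : ℕ) : ∀ᵐ ω ∂P, X n ω = 0 ∨ X n ω = 1 := by
  have h0 : MeasurableSet {ω | X n ω = 0} := hV.measurable_X n (MeasurableSet.singleton 0)
  have h1 : MeasurableSet {ω | X n ω = 1} := hV.measurable_X n (MeasurableSet.singleton 1)
  have hp : 0 < 1 + θ * (Nat.card F : ℝ) ^ n := by positivity
  have h2 : P.real ({ω | X n ω = 0} ∪ {ω | X n ω = 1}) = 1 := by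
    rw [measureReal_union _ h1, hV.prob_X_one, hV.prob_X_zero]
    · field_simp
    · rw [Set.disjoint_left]
      intro ω h h'
      simp only [Set.mem_ofPred_eq] at h h'
      omega
  have h3 := (prob_compl_eq_zero_iff (μ := P) (h0.union h1)).2 (by
    rwa [Measure.real, ENNReal.toReal_eq_one_iff] at h2)
  rw [ae_iff]
  exact h3

theorem real_V_succ [IsProbabilityMeasure P] (hV : IsGrassmannianProcess j θ P X V)
    (hθ : 0 < θ) (n : ℕ) (v : Gr F (n + 1)) [Fintype (Gr F n)] :
    P.real {ω | V (n + 1) ω = v} = ∑ w : Gr F n, P.real {ω | V n ω = w} *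
      (P.real {ω | X n ω = 0} * Set.indicator {w.map (j n)} (fun _ => (1 : ℝ)) v +
       P.real {ω | X n ω = 1} * (Set.indicator (dilations (j n) w) (fun _ => (1 : ℝ)) v /
          ((dilations (j n) w).ncard : ℝ))) := by
  have hm : ∀ (w : Gr F n) (x : ℕ), MeasurableSet ({ω | V n ω = w} ∩ {ω | X n ω = x}) :=
    fun w x => (measurableSet_Gr_eq (hV.measurable_V n) {w}).inter
      (hV.measurable_X n (MeasurableSet.singleton x))
  have hmv : MeasurableSet {ω | V (n + 1) ω = v} :=
    measurableSet_Gr_eq (hV.measurable_V (n + 1)) {v}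
  have hterm : ∀ w : Gr F n, P.real {ω | V n ω = w} *
      (P.real {ω | X n ω = 0} * Set.indicator {w.map (j n)} (fun _ => (1 : ℝ)) v +
       P.real {ω | X n ω = 1} * (Set.indicator (dilations (j n) w) (fun _ => (1 : ℝ)) v /
          ((dilations (j n) w).ncard : ℝ))) =
      P.real ({ω | V n ω = w} ∩ {ω | V (n + 1) ω = v}) := by
    intro w
    rw [mul_add, ← mul_assoc, ← mul_assoc, ← hV.real_inter_X, ← hV.real_inter_X,
      ← real_inter_eq_of_cond (hm w 0) (hV.cond_zero n w v),
      ← real_inter_eq_of_cond (hm w 1) (hV.cond_one n w v),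
      ← measureReal_union _ ((hm w 1).inter hmv)]
    · apply measureReal_congr
      filter_upwards [hV.ae_X hθ n] with ω hω
      apply propext
      change ((V n ω = w ∧ X n ω = 0) ∧ V (n + 1) ω = v) ∨ ((V n ω = w ∧ X n ω = 1) ∧ V (n + 1) ω = v)
        ↔ (V n ω = w ∧ V (n + 1) ω = v)
      tauto
    · rw [Set.disjoint_left]
      rintro ω ⟨⟨-, h⟩, -⟩ ⟨⟨-, h'⟩, -⟩
      simp only [Set.mem_ofPred_eq] at h h'
      omega
  rw [Finset.sum_congr rfl fun w _ => hterm w, ← measureReal_biUnion_finset]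
  · congr 1
    ext ω
    simp
  · intro w _ w' _ hne
    refine Set.disjoint_left.2 fun ω h h' => hne (h.1.symm.trans h'.1)
  · exact fun w _ => (measurableSet_Gr_eq (hV.measurable_V n) {w}).inter hmv

theorem real_V_succ_of_le_range [Finite F] [IsProbabilityMeasure P]
    (hV : IsGrassmannianProcess j θ P X V) (hj : ∀ n, Function.Injective (j n)) (hθ : 0 < θ) (n : ℕ)
    {v : Gr F (n + 1)} (hv : v ≤ LinearMap.range (j n)) :
    P.real {ω | V (n + 1) ω = v} =
      P.real {ω | V n ω = v.comap (j n)} * (1 / (1 + θ * (Nat.card F : ℝ) ^ n)) := by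
  classical
  have := Fintype.ofFinite (Gr F n)
  rw [hV.real_V_succ hθ, Finset.sum_eq_single (v.comap (j n)), hV.prob_X_zero,
    Set.indicator_of_mem, Set.indicator_of_notMem]
  · simp
  · exact fun h => h.2.1 hv
  · exact (Submodule.map_comap_eq_of_le hv).symm
  · intro w _ hw
    rw [Set.indicator_of_notMem, Set.indicator_of_notMem]
    · simp
    · exact fun h => h.2.1 hv
    · rintro rfl
      exact hw (Submodule.comap_map_eq_of_injective (hj n) w).symm
  · simp

theorem real_V_succ_of_not_le_range [Finite F] [IsProbabilityMeasure P]
    (hV : IsGrassmannianProcess j θ P X V) (hj : ∀ n, Function.Injective (j n)) (hθ : 0 < θ) (n : ℕ)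
    {v : Gr F (n + 1)} (hv : ¬ v ≤ LinearMap.range (j n)) :
    P.real {ω | V (n + 1) ω = v} = P.real {ω | V n ω = v.comap (j n)} *
      (θ * (Nat.card F : ℝ) ^ n / (1 + θ * (Nat.card F : ℝ) ^ n) /
        ((dilations (j n) (v.comap (j n))).ncard : ℝ)) := by
  classical
  have := Fintype.ofFinite (Gr F n)
  have hmap : ∀ w : Gr F n, v ∉ ({w.map (j n)} : Set (Gr F (n + 1))) := by
    rintro w rfl
    exact hv LinearMap.map_le_range
  rw [hV.real_V_succ hθ, Finset.sum_eq_single (v.comap (j n)), hV.prob_X_one,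
    Set.indicator_of_notMem (hmap _), Set.indicator_of_mem]
  · ring
  · exact (mem_dilations_iff (hj n)).2 ⟨hv, rfl⟩
  · intro w _ hw
    rw [Set.indicator_of_notMem (hmap w), Set.indicator_of_notMem]
    · simp
    · exact fun h => hw ((mem_dilations_iff (hj n)).1 h).2.symm
  · simp

end IsGrassmannianProcess

/-- The probability that the Grassmannian process of parameter `θ` over a field with `Q` elements
is at a given subspace of codimension `d` at time `n`. -/
noncomputable def codimMass (Q θ : ℝ) (n d : ℕ) : ℝ :=
  Q ^ ((d + 1).choose 2) /
    (Q ^ (n * d) * θ ^ d * ∏ i ∈ Finset.range n, (1 + θ⁻¹ * Q⁻¹ ^ i))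

theorem IsGrassmannianProcess.real_V_eq [Finite F] [IsProbabilityMeasure P]
    (hV : IsGrassmannianProcess j θ P X V)
    (hj : ∀ n, Function.Injective (j n)) (hθ : 0 < θ)
    (n d : ℕ) (v : Gr F n) (hv : Module.finrank F v + d = n) :
    P.real {ω | V n ω = v} = codimMass (Nat.card F) θ n d := by
  have hQ : (0 : ℝ) < Nat.card F := Nat.cast_pos.2 Nat.card_pos
  induction n generalizing d with
  | zero =>
    obtain rfl : d = 0 := by omega
    have : {ω | V 0 ω = v} = Set.univ := by
      ext ω
      simp [hV.V_zero, Subsingleton.elim v ⊥]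
    simp [this, codimMass]
  | succ n ih =>
    have hpos : ∀ i, 0 < 1 + θ⁻¹ * (Nat.card F : ℝ)⁻¹ ^ i := fun i => by positivity
    have hprod := (Finset.prod_pos (s := Finset.range n) fun i _ => hpos i).ne'
    have hn := (hpos n).ne'
    -- This exposes the factor by which the product in `codimMass` grows from `n` to `n + 1`.
    have e1 : 1 + θ * (Nat.card F : ℝ) ^ n =
        θ * (Nat.card F : ℝ) ^ n * (1 + θ⁻¹ * (Nat.card F : ℝ)⁻¹ ^ n) := by
      rw [inv_pow]; field_simp; ring
    by_cases h : v ≤ LinearMap.range (j n)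
    · have h1 := finrank_comap_of_le_range (hj n) h
      -- A subspace of the hyperplane has positive codimension in `F ^ (n + 1)`.
      obtain ⟨e, rfl⟩ : ∃ e, d = e + 1 := ⟨d - 1, by
        have := Submodule.finrank_le (v.comap (j n))
        rw [Module.finrank_fin_fun] at this
        omega⟩
      rw [hV.real_V_succ_of_le_range hj hθ n h, ih e _ (by omega), e1, codimMass, codimMass,
        Finset.prod_range_succ, Nat.choose_succ_succ' (e + 1) 1, Nat.choose_one_right,
        show (n + 1) * (e + 1) = n * e + n + (e + 1) by ring]
      generalize 1 + θ⁻¹ * (Nat.card F : ℝ)⁻¹ ^ n = a at *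
      rw [pow_add, pow_add, pow_add]
      field_simp
      ring
    · have h1 := finrank_eq_finrank_comap_add_one (hj n) h
      rw [hV.real_V_succ_of_not_le_range hj hθ n h, ncard_dilations (hj n) _ (d := d) (by omega),
        ih d _ (by omega), e1, codimMass, codimMass, Finset.prod_range_succ, add_mul, one_mul]
      generalize 1 + θ⁻¹ * (Nat.card F : ℝ)⁻¹ ^ n = a at *
      push_cast
      rw [pow_add]
      field_simp

end Law

/-! ### Infinite Pochhammer symbols. -/

section Pochhammer

theorem pow_mul_prod_range (c : ℝ) (f : ℕ → ℝ) (d : ℕ) :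
    c ^ d * ∏ i ∈ Finset.range d, f i = ∏ i ∈ Finset.range d, c * f i := by
  rw [Finset.prod_mul_distrib, Finset.prod_const, Finset.card_range]

theorem one_le_prod_one_sub_neg_mul_pow {a x : ℝ} (ha : 0 ≤ a) (hx0 : 0 ≤ x) (n : ℕ) :
    1 ≤ ∏ k ∈ Finset.range n, (1 - -a * x ^ k) := by
  refine Finset.prod_induction _ (1 ≤ ·) (fun _ _ => one_le_mul_of_one_le_of_one_le) le_rfl
    fun k _ => ?_
  have : 0 ≤ a * x ^ k := by positivity
  linarith

theorem summable_mul_pow {a x : ℝ} (hx0 : 0 ≤ x) (hx1 : x < 1) :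
    Summable fun k : ℕ => ‖-(a * x ^ k)‖ := by
  simp only [norm_neg, norm_mul, norm_pow, Real.norm_of_nonneg hx0]
  exact (summable_geometric_of_lt_one hx0 hx1).mul_left _

theorem multipliable_one_sub_mul_pow {a x : ℝ} (hx0 : 0 ≤ x) (hx1 : x < 1) :
    Multipliable fun k : ℕ => 1 - a * x ^ k := by
  simpa only [sub_eq_add_neg] using multipliable_one_add_of_summable (summable_mul_pow hx0 hx1)

theorem tendsto_prod_qPochInf {a x : ℝ} (hx0 : 0 ≤ x) (hx1 : x < 1) :
    Tendsto (fun n => ∏ k ∈ Finset.range n, (1 - a * x ^ k)) atTop (𝓝 (qPochInf a x)) :=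
  (multipliable_one_sub_mul_pow hx0 hx1).tendsto_prod_tprod_nat

theorem qPochInf_ne_zero {a x : ℝ} (hx0 : 0 ≤ x) (hx1 : x < 1)
    (h : ∀ k : ℕ, 1 - a * x ^ k ≠ 0) : qPochInf a x ≠ 0 := by
  simp only [qPochInf, sub_eq_add_neg] at h ⊢
  exact tprod_one_add_ne_zero_of_summable h (summable_mul_pow hx0 hx1)

theorem qPochInf_eq_prod_mul {a x : ℝ} (hx0 : 0 ≤ x) (hx1 : x < 1) (d : ℕ) :
    qPochInf a x = (∏ k ∈ Finset.range d, (1 - a * x ^ k)) * qPochInf (a * x ^ d) x := by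
  have h := (multipliable_one_sub_mul_pow (a := a * x ^ d) hx0 hx1)
  simp only [qPochInf]
  rw [← Multipliable.prod_mul_tprod_nat_mul' (k := d)]
  · congr 1
    exact tprod_congr fun k => by ring
  · exact h.congr fun k => by ring

theorem one_le_qPochInf_neg {a x : ℝ} (ha : 0 ≤ a) (hx0 : 0 ≤ x) (hx1 : x < 1) :
    1 ≤ qPochInf (-a) x := by
  exact ge_of_tendsto' (tendsto_prod_qPochInf hx0 hx1)
    (one_le_prod_one_sub_neg_mul_pow ha hx0)

end Pochhammer

/-! ### Algebraic form of the limit mass. -/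

section LimitMass

/-- Expanding the square leaves the exponent `(d + 1).choose 2 - d * d - d * logb q θ`, and the
quotient of the two Pochhammer symbols in `q⁻¹` telescopes to a finite product. -/
theorem limitMass_eq {q : ℕ} (hq : 1 < q) {θ : ℝ} (hθ : 0 < θ) (d : ℕ) :
    limitMass q θ d = (q : ℝ) ^ ((d + 1).choose 2) /
      (θ ^ d * ∏ i ∈ Finset.range d, ((q : ℝ) ^ d - (q : ℝ) ^ i)) /
        qPochInf (-θ⁻¹) (q : ℝ)⁻¹ := by
  have hQ : (1 : ℝ) < q := by exact_mod_cast hq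
  have hQ0 : (0 : ℝ) < q := by linarith
  have hx0 : 0 ≤ (q : ℝ)⁻¹ := by positivity
  have hx1 : (q : ℝ)⁻¹ < 1 := inv_lt_one_of_one_lt₀ hQ
  have h1 : (q : ℝ) ^ (-(1 / 2 : ℝ) * ((d : ℝ) - (1 / 2 - Real.logb q θ)) ^ 2
      + (1 / 2 : ℝ) * (1 / 2 - Real.logb q θ) ^ 2) =
      (q : ℝ) ^ ((d + 1).choose 2) / (q : ℝ) ^ (d * d) / θ ^ d := by
    have : -(1 / 2 : ℝ) * ((d : ℝ) - (1 / 2 - Real.logb q θ)) ^ 2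
      + (1 / 2 : ℝ) * (1 / 2 - Real.logb q θ) ^ 2 =
      (((d + 1).choose 2 : ℕ) : ℝ) - ((d * d : ℕ) : ℝ) - Real.logb q θ * (d : ℝ) := by
      rw [Nat.cast_choose_two]
      push_cast
      ring
    rw [this, Real.rpow_sub hQ0, Real.rpow_sub hQ0, Real.rpow_natCast, Real.rpow_natCast,
      Real.rpow_mul hQ0.le, Real.rpow_logb hQ0 hQ.ne' hθ, Real.rpow_natCast]
  have h2 : ∏ i ∈ Finset.range d, ((q : ℝ) ^ d - (q : ℝ) ^ i) =
      (q : ℝ) ^ (d * d) * ∏ i ∈ Finset.range d, (1 - (q : ℝ)⁻¹ * (q : ℝ)⁻¹ ^ i) := by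
    rw [← Finset.prod_range_reflect (fun i => 1 - (q : ℝ)⁻¹ * (q : ℝ)⁻¹ ^ i), pow_mul,
      pow_mul_prod_range]
    refine Finset.prod_congr rfl fun i hi => ?_
    have hi' := Finset.mem_range.1 hi
    obtain ⟨e, rfl⟩ : ∃ e, d = i + e + 1 := ⟨d - i - 1, by omega⟩
    rw [show i + e + 1 - 1 - i = e by omega, mul_sub, ← pow_succ', mul_one, inv_pow,
      show i + e + 1 = i + (e + 1) by ring, pow_add _ i, mul_assoc, mul_inv_cancel₀ (by positivity),
      mul_one]
  have hne : ∀ k : ℕ, 1 - (q : ℝ)⁻¹ ^ (d + 1) * (q : ℝ)⁻¹ ^ k ≠ 0 := fun k => by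
    rw [← pow_add]
    exact (sub_pos.2 (pow_lt_one₀ hx0 hx1 (by omega))).ne'
  have h3 := qPochInf_ne_zero hx0 hx1 hne
  rw [limitMass, h1, h2, qPochInf_eq_prod_mul (a := (q : ℝ)⁻¹) hx0 hx1 d, ← pow_succ']
  generalize ∏ i ∈ Finset.range d, (1 - (q : ℝ)⁻¹ * (q : ℝ)⁻¹ ^ i) = b
  generalize qPochInf ((q : ℝ)⁻¹ ^ (d + 1)) (q : ℝ)⁻¹ = c at *
  field_simp

theorem prod_pow_sub_pow_pos {Q : ℝ} (hQ : 1 < Q) (d : ℕ) :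
    0 < ∏ i ∈ Finset.range d, (Q ^ d - Q ^ i) :=
  Finset.prod_pos fun _ hi => sub_pos.2 (pow_lt_pow_right₀ hQ (Finset.mem_range.1 hi))

theorem inv_pos_lt_one_of_one_lt {q : ℕ} (hq : 1 < q) : 0 < (q : ℝ)⁻¹ ∧ (q : ℝ)⁻¹ < 1 := by
  have hQ : (1 : ℝ) < q := by exact_mod_cast hq
  exact ⟨by positivity, inv_lt_one_of_one_lt₀ hQ⟩

theorem limitMass_pos {q : ℕ} (hq : 1 < q) {θ : ℝ} (hθ : 0 < θ) (d : ℕ) :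
    0 < limitMass q θ d := by
  have hQ : (1 : ℝ) < q := by exact_mod_cast hq
  have hx := inv_pos_lt_one_of_one_lt hq
  have h1 := prod_pow_sub_pow_pos hQ d
  have h2 := one_le_qPochInf_neg (a := θ⁻¹) (by positivity) hx.1.le hx.2
  rw [limitMass_eq hq hθ]
  positivity

end LimitMass

/-! ### Convergence in law of the codimension. -/

section Codimension

variable {F : Type*} [Field F] [Finite F] {j : (n : ℕ) → (Fin n → F) →ₗ[F] (Fin (n + 1) → F)}

/-- Writes the finite-`n` codimension law as the limit mass times two corrections tending to `1`: a
product of `d` factors, and the Pochhammer symbol over its truncation at `n`. -/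
theorem ncard_codimSet_mul_codimMass (hj : ∀ n, Function.Injective (j n)) {θ : ℝ} (hθ : 0 < θ)
    (n d : ℕ) :
    ((codimSet F n d).ncard : ℝ) * codimMass (Nat.card F) θ n d =
      (∏ i ∈ Finset.range d, (1 - (Nat.card F : ℝ) ^ i * (Nat.card F : ℝ)⁻¹ ^ n)) *
        (limitMass (Nat.card F) θ d * qPochInf (-θ⁻¹) (Nat.card F : ℝ)⁻¹) /
          ∏ i ∈ Finset.range n, (1 - -θ⁻¹ * (Nat.card F : ℝ)⁻¹ ^ i) := by
  have hq : 1 < Nat.card F := Finite.one_lt_card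
  have hQ : (1 : ℝ) < Nat.card F := by exact_mod_cast hq
  have hQ0 : (0 : ℝ) < Nat.card F := by linarith
  have hx := inv_pos_lt_one_of_one_lt hq
  have h1 := prod_pow_sub_pow_pos hQ d
  have h2 : 0 < qPochInf (-θ⁻¹) (Nat.card F : ℝ)⁻¹ :=
    zero_lt_one.trans_le (one_le_qPochInf_neg (by positivity) hx.1.le hx.2)
  have h3 := ncard_codimSet_mul_prod hj n d
  have h4 : ∏ i ∈ Finset.range d, ((Nat.card F : ℝ) ^ n - (Nat.card F : ℝ) ^ i) =
      (Nat.card F : ℝ) ^ (n * d) *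
        ∏ i ∈ Finset.range d, (1 - (Nat.card F : ℝ) ^ i * (Nat.card F : ℝ)⁻¹ ^ n) := by
    rw [pow_mul, pow_mul_prod_range]
    refine Finset.prod_congr rfl fun i hi => ?_
    rw [mul_sub, mul_left_comm, inv_pow, mul_inv_cancel₀ (by positivity), mul_one, mul_one]
  rw [← eq_div_iff h1.ne', h4] at h3
  rw [limitMass_eq hq hθ, codimMass, h3, div_mul_cancel₀ _ h2.ne']
  have h5 : ∏ i ∈ Finset.range n, (1 + θ⁻¹ * (Nat.card F : ℝ)⁻¹ ^ i) =
      ∏ i ∈ Finset.range n, (1 - -θ⁻¹ * (Nat.card F : ℝ)⁻¹ ^ i) :=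
    Finset.prod_congr rfl fun i _ => by ring
  have h6 : 0 < ∏ i ∈ Finset.range n, (1 + θ⁻¹ * (Nat.card F : ℝ)⁻¹ ^ i) :=
    Finset.prod_pos fun i _ => by positivity
  rw [← h5]
  generalize ∏ i ∈ Finset.range d, (1 - (Nat.card F : ℝ) ^ i * (Nat.card F : ℝ)⁻¹ ^ n) = b
  generalize ∏ i ∈ Finset.range n, (1 + θ⁻¹ * (Nat.card F : ℝ)⁻¹ ^ i) = c at *
  field_simp

variable {θ : ℝ} {Ω : Type*} [MeasurableSpace Ω] {P : Measure Ω} [IsProbabilityMeasure P]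
  {X : ℕ → Ω → ℕ} {V : (n : ℕ) → Ω → Gr F n}

theorem IsGrassmannianProcess.real_mem_eq_ncard_mul (hV : IsGrassmannianProcess j θ P X V)
    (hj : ∀ n, Function.Injective (j n)) (hθ : 0 < θ) {n d : ℕ} {s : Set (Gr F n)}
    (hs : s ⊆ codimSet F n d) :
    P.real {ω | V n ω ∈ s} = s.ncard * codimMass (Nat.card F) θ n d := by
  classical
  have := Fintype.ofFinite (Gr F n)
  have h1 : {ω | V n ω ∈ s} = ⋃ w ∈ s.toFinset, {ω | V n ω = w} := by
    ext ω; simp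
  rw [h1, measureReal_biUnion_finset, Set.ncard_eq_toFinset_card', ← nsmul_eq_mul,
    ← Finset.sum_const]
  · exact Finset.sum_congr rfl fun w hw => hV.real_V_eq hj hθ n d w (hs (Set.mem_toFinset.1 hw))
  · exact fun w _ w' _ hne => Set.disjoint_left.2 fun ω h h' => hne (h.symm.trans h')
  · exact fun w _ => measurableSet_Gr_eq (hV.measurable_V n) {w}

theorem tendsto_codim (hV : IsGrassmannianProcess j θ P X V)
    (hj : ∀ n, Function.Injective (j n)) (hθ : 0 < θ) (d : ℕ) :
    Tendsto (fun n => P.real {ω | V n ω ∈ codimSet F n d}) atTop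
      (𝓝 (limitMass (Nat.card F) θ d)) := by
  have hq : 1 < Nat.card F := Finite.one_lt_card
  have hx := inv_pos_lt_one_of_one_lt hq
  have h2 : 0 < qPochInf (-θ⁻¹) (Nat.card F : ℝ)⁻¹ :=
    zero_lt_one.trans_le (one_le_qPochInf_neg (by positivity) hx.1.le hx.2)
  have h3 : Tendsto (fun n => ∏ i ∈ Finset.range d,
      (1 - (Nat.card F : ℝ) ^ i * (Nat.card F : ℝ)⁻¹ ^ n)) atTop (𝓝 1) := by
    have := tendsto_finsetProd (Finset.range d) (f := fun i n =>
      (1 - (Nat.card F : ℝ) ^ i * (Nat.card F : ℝ)⁻¹ ^ n)) (x := atTop) (a := fun _ => 1)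
      fun i _ => by
        simpa using ((tendsto_pow_atTop_nhds_zero_of_lt_one hx.1.le hx.2).const_mul
          ((Nat.card F : ℝ) ^ i)).const_sub 1
    simpa using this
  have h4 := (h3.mul_const (limitMass (Nat.card F) θ d * qPochInf (-θ⁻¹) (Nat.card F : ℝ)⁻¹)).div
    (tendsto_prod_qPochInf (a := -θ⁻¹) hx.1.le hx.2) h2.ne'
  rw [one_mul, mul_div_cancel_right₀ _ h2.ne'] at h4
  refine h4.congr fun n => ?_
  rw [hV.real_mem_eq_ncard_mul hj hθ subset_rfl, ncard_codimSet_mul_codimMass hj hθ]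
  rfl

/-- A bound independent of `n`, to serve as the dominating sequence in `hasSum_limitMass`. -/
theorem real_codim_le (hV : IsGrassmannianProcess j θ P X V)
    (hj : ∀ n, Function.Injective (j n)) (hθ : 0 < θ) (n d : ℕ) :
    P.real {ω | V n ω ∈ codimSet F n d} ≤
      limitMass (Nat.card F) θ d * qPochInf (-θ⁻¹) (Nat.card F : ℝ)⁻¹ := by
  have hq : 1 < Nat.card F := Finite.one_lt_card
  have hQ : (1 : ℝ) < Nat.card F := by exact_mod_cast hq
  have hx := inv_pos_lt_one_of_one_lt hq
  have h1 := limitMass_pos hq hθ d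
  have h2 : 0 < qPochInf (-θ⁻¹) (Nat.card F : ℝ)⁻¹ :=
    zero_lt_one.trans_le (one_le_qPochInf_neg (by positivity) hx.1.le hx.2)
  rcases lt_or_ge n d with h | h
  -- For `n < d` some factors `1 - q ^ (i - n)` may be negative, so the factorwise bound below is
  -- reserved for `d ≤ n`.
  · rw [show codimSet F n d = ∅ from Set.eq_empty_of_forall_notMem fun w hw => by
      change _ = _ at hw; omega]
    simp only [Set.mem_empty_iff_false, Set.ofPred_false, measureReal_empty]
    positivity
  rw [hV.real_mem_eq_ncard_mul hj hθ subset_rfl, ncard_codimSet_mul_codimMass hj hθ]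
  have h3 : 1 ≤ ∏ i ∈ Finset.range n, (1 - -θ⁻¹ * (Nat.card F : ℝ)⁻¹ ^ i) :=
    one_le_prod_one_sub_neg_mul_pow (by positivity) hx.1.le n
  have h4 : ∀ i ∈ Finset.range d, 0 ≤ 1 - (Nat.card F : ℝ) ^ i * (Nat.card F : ℝ)⁻¹ ^ n := by
    intro i hi
    rw [inv_pow, ← div_eq_mul_inv, sub_nonneg]
    exact div_le_one_of_le₀ (pow_le_pow_right₀ hQ.le (by
      have := Finset.mem_range.1 hi; omega)) (by positivity)
  refine (div_le_self (mul_nonneg (Finset.prod_nonneg h4) (by positivity)) h3).trans ?_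
  refine mul_le_of_le_one_left (by positivity) (Finset.prod_le_one h4 fun i _ => ?_)
  rw [sub_le_self_iff]; positivity

theorem sum_real_codim (hV : IsGrassmannianProcess j θ P X V) (n : ℕ) (s : Finset ℕ) :
    ∑ d ∈ s, P.real {ω | V n ω ∈ codimSet F n d} =
      P.real {ω | ∃ d ∈ s, V n ω ∈ codimSet F n d} := by
  rw [← measureReal_biUnion_finset]
  · congr 1
    ext ω; simp
  · intro d _ d' _ hne
    refine Set.disjoint_left.2 fun ω h h' => hne ?_
    change _ = _ at h
    change _ = _ at h'
    omega
  · exact fun d _ => measurableSet_Gr_eq (hV.measurable_V n) _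

theorem hasSum_real_codim (hV : IsGrassmannianProcess j θ P X V) (n : ℕ) :
    HasSum (fun d => P.real {ω | V n ω ∈ codimSet F n d}) 1 := by
  have h1 : ∑ d ∈ Finset.range (n + 1), P.real {ω | V n ω ∈ codimSet F n d} = 1 := by
    rw [sum_real_codim hV, ← probReal_univ (μ := P)]
    congr 1
    refine Set.eq_univ_of_forall fun ω => ?_
    have := Submodule.finrank_le (V n ω)
    rw [Module.finrank_fin_fun] at this
    exact ⟨n - Module.finrank F (V n ω), Finset.mem_range.2 (by omega),
      show _ = _ by omega⟩
  rw [← h1]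
  refine hasSum_sum_of_ne_finset_zero fun d hd => ?_
  rw [show codimSet F n d = ∅ from Set.eq_empty_of_forall_notMem fun w hw => by
    change _ = _ at hw
    have := Finset.mem_range.not.1 hd
    omega]
  simp

/-- Limits of partial sums of probabilities are at most `1`, which gives summability. Dominated
convergence then passes the total mass `1` to the limit. -/
theorem hasSum_limitMass (hV : IsGrassmannianProcess j θ P X V)
    (hj : ∀ n, Function.Injective (j n)) (hθ : 0 < θ) :
    HasSum (limitMass (Nat.card F) θ) 1 := by
  have hq : 1 < Nat.card F := Finite.one_lt_card
  have hs : Summable (limitMass (Nat.card F) θ) := by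
    refine summable_of_sum_range_le (c := 1) (fun d => (limitMass_pos hq hθ d).le) fun m => ?_
    refine le_of_tendsto' (tendsto_finsetSum (Finset.range m)
      fun d _ => tendsto_codim hV hj hθ d) fun n => ?_
    rw [sum_real_codim hV]
    exact measureReal_le_one
  have h := tendsto_tsum_of_dominated_convergence
    (hs.mul_right (qPochInf (-θ⁻¹) (Nat.card F : ℝ)⁻¹)) (tendsto_codim hV hj hθ)
    (Eventually.of_forall fun n d => by
      rw [Real.norm_of_nonneg measureReal_nonneg]
      exact real_codim_le hV hj hθ n d)
  simp only [(hasSum_real_codim hV _).tsum_eq] at h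
  rw [tendsto_nhds_unique tendsto_const_nhds h]
  exact hs.hasSum

end Codimension

/-! ### Block codes as sets of decodable subspaces. -/

section BlockCodes

variable {F : Type*} [Field F] [Finite F] {n q : ℕ} {Ω : Type*} [MeasurableSpace Ω]
  {P : Measure Ω} {W : Ω → Gr F n} {ε : ℝ}

theorem minCodeLength_le_of_ncard_le (hq : 0 < q) {k : ℕ} {s : Set (Gr F n)}
    (hs : s.ncard ≤ q ^ k) (hP : P.real {ω | W ω ∉ s} ≤ ε) [IsFiniteMeasure P] :
    minCodeLength P W q ε ≤ k := by
  classical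
  have := Fintype.ofFinite (Gr F n)
  have : Nonempty (Fin q) := ⟨⟨0, hq⟩⟩
  have hcard : Fintype.card s ≤ Fintype.card (Fin k → Fin q) := by
    rw [Set.ncard_eq_toFinset_card', Set.toFinset_card] at hs
    simpa using hs
  obtain ⟨e⟩ := Function.Embedding.nonempty_of_card_le hcard
  let f : Gr F n → (Fin k → Fin q) := fun w => if h : w ∈ s then e ⟨w, h⟩ else Classical.arbitrary _
  have hf : Set.InjOn f s := by
    intro w hw w' hw' h
    simp only [f, dif_pos hw, dif_pos hw'] at h
    exact congrArg Subtype.val (e.injective h)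
  refine Nat.sInf_le ⟨f, Function.invFunOn f s, (measureReal_mono ?_).trans hP⟩
  exact fun ω hω h => hω (hf.leftInvOn_invFunOn h)

/-- A code can be correct only on the range of its decoder, which has at most as many elements as
there are codewords. -/
theorem exists_ncard_le_pow_minCodeLength [IsProbabilityMeasure P] (hW : Measurable W)
    (hq : 2 ≤ q) (hε : 0 ≤ ε) :
    ∃ s : Set (Gr F n), s.ncard ≤ q ^ minCodeLength P W q ε ∧ 1 - ε ≤ P.real {ω | W ω ∈ s} := by
  obtain ⟨f, φ, h⟩ := Nat.sInf_mem (exists_code_error_le P W q hq ε hε)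
  change Gr F n → Fin (minCodeLength P W q ε) → Fin q at f
  change (Fin (minCodeLength P W q ε) → Fin q) → Gr F n at φ
  refine ⟨Set.range φ, ?_, ?_⟩
  · rw [← Set.image_univ]
    refine (Set.ncard_image_le Set.finite_univ).trans_eq ?_
    rw [Set.ncard_univ, Nat.card_fun, Nat.card_fin, Nat.card_fin]
  · have h1 : P.real {ω | W ω ∈ Set.range φ}ᶜ ≤ ε := by
      refine (measureReal_mono ?_).trans h
      exact fun ω hω h' => hω ⟨_, h'⟩
    rw [probReal_compl_eq_one_sub (measurableSet_Gr_eq hW _)] at h1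
    linarith

end BlockCodes

/-! ### Strict inequalities at the quantile. -/

section Quantile

/-- A continuous integer-valued function is locally constant, so some `x > p` has the same quantile
index; the partial sum is at least `x`, hence exceeds `p`. -/
theorem sum_limitMass_quantileIndex_gt {q : ℕ} {θ p : ℝ} (hsum : HasSum (limitMass q θ) 1)
    (hp0 : 0 ≤ p) (hp1 : p < 1)
    (hcont : ContinuousWithinAt (quantileIndex q θ) (Set.Ico 0 1) p) :
    p < ∑ k ∈ Finset.range (quantileIndex q θ p + 1), limitMass q θ k := by
  have h1 : ∀ᶠ x in 𝓝[Set.Ioo p 1] p, quantileIndex q θ x = quantileIndex q θ p := by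
    have h := (hcont.mono (s := Set.Ioo p 1) fun x hx => ⟨hp0.trans hx.1.le, hx.2⟩).tendsto
    rw [nhds_discrete] at h
    exact tendsto_pure.1 h
  have := left_nhdsWithin_Ioo_neBot hp1
  obtain ⟨x, hx, hxp⟩ := (h1.and self_mem_nhdsWithin).exists
  rw [← hx]
  refine hxp.1.trans_le ?_
  obtain ⟨d, hd⟩ := ((hsum.tendsto_sum_nat.comp (tendsto_add_atTop_nat 1)).eventually
    (lt_mem_nhds hxp.2)).exists
  exact Nat.sInf_mem (s := {d : ℕ | x ≤ ∑ k ∈ Finset.range (d + 1), limitMass q θ k}) ⟨d, hd.le⟩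

theorem sum_limitMass_range_quantileIndex_lt {q : ℕ} {θ p : ℝ} (h : quantileIndex q θ p ≠ 0) :
    ∑ k ∈ Finset.range (quantileIndex q θ p), limitMass q θ k < p := by
  obtain ⟨e, he⟩ := Nat.exists_eq_succ_of_ne_zero h
  have h1 := Nat.notMem_of_lt_sInf (s := {d : ℕ | p ≤ ∑ k ∈ Finset.range (d + 1), limitMass q θ k})
    (m := e) (by rw [quantileIndex] at he; omega)
  rw [he]
  exact not_le.1 h1

end Quantile

/-! ### Two-sided bounds on the code length. -/

section Asymptotics

variable {F : Type*} [Field F] [Finite F] {j : (n : ℕ) → (Fin n → F) →ₗ[F] (Fin (n + 1) → F)}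
  {θ : ℝ} {Ω : Type*} [MeasurableSpace Ω] {P : Measure Ω} [IsProbabilityMeasure P]
  {X : ℕ → Ω → ℕ} {V : (n : ℕ) → Ω → Gr F n}

theorem one_le_card_pow (F : Type*) [Field F] [Finite F] (m : ℕ) :
    1 ≤ (Nat.card F : ℝ) ^ m :=
  one_le_pow₀ (by exact_mod_cast Nat.card_pos (α := F))

theorem prod_le_qPochInf {a x : ℝ} (ha : 0 ≤ a) (hx0 : 0 ≤ x) (hx1 : x < 1) (n : ℕ) :
    ∏ i ∈ Finset.range n, (1 + a * x ^ i) ≤ qPochInf (-a) x := by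
  have h := tendsto_prod_qPochInf (a := -a) hx0 hx1
  simp only [neg_mul, sub_neg_eq_add] at h
  refine Monotone.ge_of_tendsto (monotone_nat_of_le_succ fun n => ?_) h n
  rw [Finset.prod_range_succ]
  refine le_mul_of_one_le_right (Finset.prod_nonneg fun i _ => by positivity) ?_
  have : 0 ≤ a * x ^ n := by positivity
  linarith

/-- The class has probability at most `1` and its points are equally likely, so its size is at most
the inverse of the point mass. -/
theorem ncard_codimSet_le (hV : IsGrassmannianProcess j θ P X V)
    (hj : ∀ n, Function.Injective (j n)) (hθ : 0 < θ) (n d : ℕ) :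
    ((codimSet F n d).ncard : ℝ) ≤
      (Nat.card F : ℝ) ^ (n * d) * (θ ^ d * qPochInf (-θ⁻¹) (Nat.card F : ℝ)⁻¹) := by
  have hx := inv_pos_lt_one_of_one_lt (Finite.one_lt_card (α := F))
  have hQ : (0 : ℝ) < Nat.card F := Nat.cast_pos.2 Nat.card_pos
  have hprod : 0 < ∏ i ∈ Finset.range n, (1 + θ⁻¹ * (Nat.card F : ℝ)⁻¹ ^ i) :=
    Finset.prod_pos fun i _ => by positivity
  have h1 : ((codimSet F n d).ncard : ℝ) * codimMass (Nat.card F) θ n d ≤ 1 := by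
    rw [← hV.real_mem_eq_ncard_mul hj hθ subset_rfl]
    exact measureReal_le_one
  rw [codimMass, ← mul_div_assoc, div_le_one (by positivity)] at h1
  calc ((codimSet F n d).ncard : ℝ)
      ≤ (codimSet F n d).ncard * (Nat.card F : ℝ) ^ ((d + 1).choose 2) :=
        le_mul_of_one_le_right (by positivity) (one_le_card_pow F _)
    _ ≤ _ := h1
    _ ≤ _ := by
        rw [mul_assoc]
        gcongr
        exact prod_le_qPochInf (by positivity) hx.1.le hx.2 n

theorem codimMass_le (hθ : 0 < θ) (n d : ℕ) :
    codimMass (Nat.card F) θ n d ≤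
      (Nat.card F : ℝ) ^ ((d + 1).choose 2) / θ ^ d / (Nat.card F : ℝ) ^ (n * d) := by
  have hQ : (0 : ℝ) < Nat.card F := Nat.cast_pos.2 Nat.card_pos
  have h := one_le_prod_one_sub_neg_mul_pow (a := θ⁻¹) (by positivity) (inv_pos.2 hQ).le n
  simp only [neg_mul, sub_neg_eq_add] at h
  rw [codimMass, div_div, mul_comm (θ ^ d)]
  exact div_le_div_of_nonneg_left (by positivity) (by positivity)
    (le_mul_of_one_le_right (by positivity) h)

theorem eventually_minCodeLength_le (hV : IsGrassmannianProcess j θ P X V)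
    (hj : ∀ n, Function.Injective (j n)) (hθ : 0 < θ) {ε : ℝ} {D : ℕ}
    (hD : 1 - ε < ∑ d ∈ Finset.range (D + 1), limitMass (Nat.card F) θ d) :
    ∃ c : ℕ, ∀ᶠ n in atTop, minCodeLength P (V n) (Nat.card F) ε ≤ n * D + c := by
  classical
  have hq : 1 < Nat.card F := Finite.one_lt_card
  have hx := inv_pos_lt_one_of_one_lt hq
  have hpoch := one_le_qPochInf_neg (a := θ⁻¹) (by positivity) hx.1.le hx.2
  -- The extra `c` symbols absorb the constants in the sizes of the classes of codimension at most
  -- `D`.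
  obtain ⟨c, hc⟩ := pow_unbounded_of_one_lt (∑ d ∈ Finset.range (D + 1),
    θ ^ d * qPochInf (-θ⁻¹) (Nat.card F : ℝ)⁻¹) (show (1 : ℝ) < Nat.card F by exact_mod_cast hq)
  refine ⟨c, ?_⟩
  filter_upwards [(tendsto_finsetSum (Finset.range (D + 1))
      fun d _ => tendsto_codim hV hj hθ d).eventually (lt_mem_nhds hD)] with n hn
  have := Fintype.ofFinite (Gr F n)
  refine minCodeLength_le_of_ncard_le (s := {w | ∃ d ∈ Finset.range (D + 1), w ∈ codimSet F n d})
    (by omega) ?_ ?_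
  · have h1 : {w | ∃ d ∈ Finset.range (D + 1), w ∈ codimSet F n d}.ncard ≤
        ∑ d ∈ Finset.range (D + 1), (codimSet F n d).ncard := by
      simp only [Set.ncard_eq_toFinset_card']
      refine le_trans (Finset.card_le_card fun w hw => ?_) Finset.card_biUnion_le
      simpa using hw
    have h2 : ((∑ d ∈ Finset.range (D + 1), (codimSet F n d).ncard : ℕ) : ℝ) ≤
        ((Nat.card F ^ (n * D + c) : ℕ) : ℝ) := by
      push_cast
      calc ∑ d ∈ Finset.range (D + 1), ((codimSet F n d).ncard : ℝ)
          ≤ ∑ d ∈ Finset.range (D + 1), (Nat.card F : ℝ) ^ (n * D) *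
              (θ ^ d * qPochInf (-θ⁻¹) (Nat.card F : ℝ)⁻¹) := by
            refine Finset.sum_le_sum fun d hd => (ncard_codimSet_le hV hj hθ n d).trans ?_
            gcongr
            · exact_mod_cast hq.le
            · have := Finset.mem_range.1 hd
              omega
        _ ≤ (Nat.card F : ℝ) ^ (n * D + c) := by
            rw [← Finset.mul_sum, pow_add]
            gcongr
    exact h1.trans (by exact_mod_cast h2)
  · rw [sum_real_codim hV] at hn
    have h1 := probReal_compl_eq_one_sub (μ := P) (measurableSet_Gr_eq (hV.measurable_V n)
      {w | ∃ d ∈ Finset.range (D + 1), w ∈ codimSet F n d})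
    change P.real {ω | V n ω ∈ {w | ∃ d ∈ Finset.range (D + 1), w ∈ codimSet F n d}}ᶜ ≤ ε
    rw [h1]
    change 1 - P.real {ω | ∃ d ∈ Finset.range (D + 1), V n ω ∈ codimSet F n d} ≤ ε
    linarith

/-- Splits `s` by codimension below `D`, at least `E`, and in between. The cutoff `E` keeps the last
sum finite; its terms are the constants in the point-mass bounds. -/
theorem real_mem_le_add (hV : IsGrassmannianProcess j θ P X V)
    (hj : ∀ n, Function.Injective (j n)) (hθ : 0 < θ) {n D E : ℕ}
    (s : Set (Gr F n)) :
    P.real {ω | V n ω ∈ s} ≤ ∑ d ∈ Finset.range D, P.real {ω | V n ω ∈ codimSet F n d} +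
      (1 - ∑ d ∈ Finset.range E, P.real {ω | V n ω ∈ codimSet F n d}) +
      s.ncard / (Nat.card F : ℝ) ^ (n * D) *
        ∑ d ∈ Finset.Ico D E, (Nat.card F : ℝ) ^ ((d + 1).choose 2) / θ ^ d := by
  have hQ : (1 : ℝ) < Nat.card F := by exact_mod_cast Finite.one_lt_card (α := F)
  have hm : MeasurableSet {ω | ∃ d ∈ Finset.range E, V n ω ∈ codimSet F n d} :=
    measurableSet_Gr_eq (hV.measurable_V n) {w | ∃ d ∈ Finset.range E, w ∈ codimSet F n d}
  have h1 : {ω | V n ω ∈ s} ⊆ ({ω | ∃ d ∈ Finset.range D, V n ω ∈ codimSet F n d} ∪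
      {ω | ∃ d ∈ Finset.range E, V n ω ∈ codimSet F n d}ᶜ) ∪
      ⋃ d ∈ Finset.Ico D E, {ω | V n ω ∈ s ∩ codimSet F n d} := by
    intro ω hω
    by_cases hE : ∃ d ∈ Finset.range E, V n ω ∈ codimSet F n d
    · obtain ⟨d, hd, hdω⟩ := hE
      by_cases hdD : d < D
      · exact Or.inl (Or.inl ⟨d, Finset.mem_range.2 hdD, hdω⟩)
      · refine Or.inr (Set.mem_biUnion (x := d) ?_ ⟨hω, hdω⟩)
        simpa using ⟨not_lt.1 hdD, Finset.mem_range.1 hd⟩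
    · exact Or.inl (Or.inr hE)
  refine (measureReal_mono h1).trans ((measureReal_union_le _ _).trans
    (add_le_add ((measureReal_union_le _ _).trans (add_le_add ?_ ?_)) ?_))
  · rw [sum_real_codim hV]
  · rw [sum_real_codim hV, probReal_compl_eq_one_sub hm]
  · refine (measureReal_biUnion_finset_le _ _).trans ?_
    rw [Finset.mul_sum]
    refine Finset.sum_le_sum fun d hd => ?_
    rw [hV.real_mem_eq_ncard_mul hj hθ Set.inter_subset_right, div_mul_eq_mul_div, mul_div_assoc]
    have h2 : ((s ∩ codimSet F n d).ncard : ℝ) ≤ s.ncard :=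
      Nat.cast_le.2 (Set.ncard_le_ncard Set.inter_subset_left)
    refine mul_le_mul h2 ((codimMass_le hθ n d).trans ?_) ?_ (by positivity)
    · gcongr
      · exact hQ.le
      · exact (Finset.mem_Ico.1 hd).1
    · have hprod : 0 < ∏ i ∈ Finset.range n, (1 + θ⁻¹ * (Nat.card F : ℝ)⁻¹ ^ i) :=
        Finset.prod_pos fun i _ => by positivity
      rw [codimMass]
      positivity

theorem eventually_le_minCodeLength (hV : IsGrassmannianProcess j θ P X V)
    (hj : ∀ n, Function.Injective (j n)) (hθ : 0 < θ) {ε : ℝ} (hε : 0 ≤ ε) {D : ℕ}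
    (hD : ∑ d ∈ Finset.range D, limitMass (Nat.card F) θ d < 1 - ε) :
    ∃ c : ℕ, ∀ᶠ n in atTop, n * D ≤ minCodeLength P (V n) (Nat.card F) ε + c := by
  have hq : 1 < Nat.card F := Finite.one_lt_card
  have hQ : (1 : ℝ) < Nat.card F := by exact_mod_cast hq
  -- `E` makes the tail smaller than the gap between `1 - ε` and the mass below `D`. With `δ`
  -- strictly between, the window `[D, E)` must eventually supply more than `1 - ε - δ`.
  obtain ⟨E, hE⟩ := ((hasSum_limitMass hV hj hθ).tendsto_sum_nat.eventually
    (lt_mem_nhds (show ∑ d ∈ Finset.range D, limitMass (Nat.card F) θ d + ε < 1 by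
      linarith))).exists
  obtain ⟨δ, hδ1, hδ2⟩ := exists_between (show ∑ d ∈ Finset.range D, limitMass (Nat.card F) θ d +
    (1 - ∑ d ∈ Finset.range E, limitMass (Nat.card F) θ d) < 1 - ε by linarith)
  set C := ∑ d ∈ Finset.Ico D E, (Nat.card F : ℝ) ^ ((d + 1).choose 2) / θ ^ d with hC
  obtain ⟨c, hc⟩ := pow_unbounded_of_one_lt (C / (1 - ε - δ)) hQ
  refine ⟨c, ?_⟩
  filter_upwards [((tendsto_finsetSum (Finset.range D) fun d _ => tendsto_codim hV hj hθ d).add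
    ((tendsto_finsetSum (Finset.range E) fun d _ => tendsto_codim hV hj hθ d).const_sub
      1)).eventually (gt_mem_nhds hδ1)] with n hn
  obtain ⟨s, hs1, hs2⟩ := exists_ncard_le_pow_minCodeLength (P := P) (hV.measurable_V n)
    (show 2 ≤ Nat.card F from hq) hε
  have h1 := real_mem_le_add hV hj hθ (D := D) (E := E) s
  rw [← hC] at h1
  have hC0 : 0 ≤ C := Finset.sum_nonneg fun d _ => by positivity
  have hpos : (0 : ℝ) < Nat.card F ^ (n * D) := by positivity
  have h2 : 1 - ε - δ < s.ncard / (Nat.card F : ℝ) ^ (n * D) * C := by linarith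
  rw [div_mul_eq_mul_div, lt_div_iff₀ hpos] at h2
  have h3 : (s.ncard : ℝ) ≤ (Nat.card F : ℝ) ^ minCodeLength P (V n) (Nat.card F) ε := by
    exact_mod_cast hs1
  rw [div_lt_iff₀ (by linarith)] at hc
  have h4 : (Nat.card F : ℝ) ^ (n * D) <
      (Nat.card F : ℝ) ^ (minCodeLength P (V n) (Nat.card F) ε + c) := by
    refine lt_of_mul_lt_mul_left (a := 1 - ε - δ) ?_ (by linarith)
    calc (1 - ε - δ) * (Nat.card F : ℝ) ^ (n * D) < s.ncard * C := h2
      _ ≤ (Nat.card F : ℝ) ^ minCodeLength P (V n) (Nat.card F) ε *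
          ((Nat.card F : ℝ) ^ c * (1 - ε - δ)) := by gcongr
      _ = _ := by rw [pow_add]; ring
  exact ((pow_lt_pow_iff_right₀ hQ).1 h4).le

end Asymptotics

theorem mainTheorem7 {F : Type*} [Field F] [Finite F] (q : ℕ) (hq : Nat.card F = q)
    (j : (n : ℕ) → (Fin n → F) →ₗ[F] (Fin (n + 1) → F))
    (hj : ∀ n, Function.Injective (j n))
    (θ : ℝ) (hθ : 0 < θ)
    {Ω : Type*} [MeasurableSpace Ω] (P : Measure Ω) [IsProbabilityMeasure P]
    (X : ℕ → Ω → ℕ) (V : (n : ℕ) → Ω → Gr F n)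
    (hV : IsGrassmannianProcess j θ P X V)
    (ε : ℝ) (hε : 0 < ε) (hε_one : ε ≤ 1)
    (hcont : ContinuousWithinAt (quantileIndex q θ) (Set.Ico 0 1) (1 - ε)) :
    Tendsto (fun n : ℕ => (minCodeLength P (V n) q ε : ℝ) / (n : ℝ)) atTop
      (𝓝 (quantileIndex q θ (1 - ε) : ℝ)) := by
  subst hq
  obtain ⟨c, hc⟩ := eventually_minCodeLength_le hV hj hθ
    (sum_limitMass_quantileIndex_gt (hasSum_limitMass hV hj hθ) (by linarith) (by linarith) hcont)
  obtain ⟨b, hb⟩ : ∃ b : ℕ, ∀ᶠ n in atTop, n * quantileIndex (Nat.card F) θ (1 - ε) ≤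
      minCodeLength P (V n) (Nat.card F) ε + b := by
    -- At index `0` the strict inequality for the mass below the quantile can fail (when `ε = 1`),
    -- but the lower bound is then trivial.
    by_cases h : quantileIndex (Nat.card F) θ (1 - ε) = 0
    · exact ⟨0, Eventually.of_forall fun n => by simp [h]⟩
    · exact eventually_le_minCodeLength hV hj hθ hε.le (sum_limitMass_range_quantileIndex_lt h)
  have hlow := (tendsto_const_div_atTop_nhds_zero_nat (b : ℝ)).const_sub
    (quantileIndex (Nat.card F) θ (1 - ε) : ℝ)
  have hupp := (tendsto_const_div_atTop_nhds_zero_nat (c : ℝ)).const_add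
    (quantileIndex (Nat.card F) θ (1 - ε) : ℝ)
  rw [sub_zero] at hlow
  rw [add_zero] at hupp
  refine tendsto_of_tendsto_of_tendsto_of_le_of_le' hlow hupp ?_ ?_
  · filter_upwards [hb, eventually_gt_atTop 0] with n hn hn0
    have hn0' : (0 : ℝ) < n := by exact_mod_cast hn0
    have hn' : (n : ℝ) * quantileIndex (Nat.card F) θ (1 - ε) ≤
      minCodeLength P (V n) (Nat.card F) ε + b := by exact_mod_cast hn
    rw [le_div_iff₀ hn0', sub_mul, div_mul_cancel₀ _ hn0'.ne']
    linarith
  · filter_upwards [hc, eventually_gt_atTop 0] with n hn hn0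
    have hn0' : (0 : ℝ) < n := by exact_mod_cast hn0
    have hn' : (minCodeLength P (V n) (Nat.card F) ε : ℝ) ≤
      n * quantileIndex (Nat.card F) θ (1 - ε) + c := by exact_mod_cast hn
    rw [div_le_iff₀ hn0', add_mul, div_mul_cancel₀ _ hn0'.ne']
    linarith
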